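/- Let $c,d\ge 1$ be integers, let $\mathbb{N}$ denote the set of positive integers and $[c]=\{1,\dots,c\}$, and put $I=\mathbb{N}^d\times[c]$. Let $\mathbb{Z}^{(I)}$ be the free abelian group with basis $\{\mathbf{e}_{\mathbf{i},j} : \mathbf{i}\in\mathbb{N}^d,\ j\in[c]\}$. Let $\mathrm{Sym}$ be the group of all permutations of $\mathbb{N}$ that fix all but finitely many elements; it acts on $\mathbb{Z}^{(I)}$ by the linear extension of $$\sigma(\mathbf{e}_{(i_1,\dots,i_d),j})=\mathbf{e}_{(\sigma(i_1),\dots,\sigma(i_d)),j}.$$ For $A\subseteq\mathbb{Z}^{(I)}$ write $\mathrm{Sym}(A)=\{\sigma(\mathbf{u}) : \sigma\in\mathrm{Sym},\ \mathbf{u}\in A\}$. A lattice in $\mathbb{Z}^{(I)}$ is a subgroup $L\subseteq\mathbb{Z}^{(I)}$; it is $\mathrm{Sym}$-invariant if $\mathrm{Sym}(L)\subseteq L$. An equivariant generating set of a $\mathrm{Sym}$-invariant lattice $L$ is a subset $\mathcal{B}\subseteq L$ such that $\mathrm{Sym}(\mathcal{B})$ generates the abelian group $L$. Theorem. $\mathbb{Z}^{(I)}$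 is an equivariantly Noetherian $\mathbb{Z}$-module, i.e. every $\mathrm{Sym}$-invariant lattice in $\mathbb{Z}^{(I)}$ has a finite equivariant generating set. -/

import Mathlib

namespace EquivLattice

/-- The infinite symmetric group `Sym = Sym(∞) = ⋃ₙ Sym(n)`: the group of those permutations of the
set of positive integers that fix all but finitely many elements. -/
def SymInf : Subgroup (Equiv.Perm ℕ+) where
  carrier := {σ | {i | σ i ≠ i}.Finite}
  one_mem' := by simp
  mul_mem' := by
    intro σ τ hσ hτ
    refine (Set.Finite.union hσ hτ).subset ?_
    intro i hi
    by_contra h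
    simp only [Set.mem_union, Set.mem_ofPred_eq, not_or, not_not] at h
    apply hi
    rw [Equiv.Perm.mul_apply, h.2, h.1]
  inv_mem' := by
    intro σ hσ
    refine Set.Finite.subset hσ ?_
    intro i hi h
    exact hi (Equiv.Perm.inv_eq_iff_eq.mpr h.symm)

/-- The index set `I = ℕ^d × [c]`, with `ℕ` the positive integers. -/
abbrev Idx (d c : ℕ) : Type := (Fin d → ℕ+) × Fin c

/-- The free abelian group `ℤ^{(I)}` with basis `I = ℕ^d × [c]`. -/
abbrev FreeAb (d c : ℕ) : Type := Idx d c →₀ ℤ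

/-- The diagonal action on indices: `σ (i₁, …, i_d, j) = (σ i₁, …, σ i_d, j)`. -/
def idxAct {d c : ℕ} (σ : SymInf) (p : Idx d c) : Idx d c :=
  (fun k => σ.1 (p.1 k), p.2)

/-- The action of `σ ∈ Sym` on `ℤ^{(I)}`, the additive extension of `e_{i,j} ↦ e_{σ(i),j}`. -/
noncomputable def act {d c : ℕ} (σ : SymInf) : FreeAb d c →+ FreeAb d c :=
  Finsupp.mapDomain.addMonoidHom (idxAct σ)

/-- `Sym(A) = {σ(u) | σ ∈ Sym, u ∈ A}`. -/
def orbitSet {d c : ℕ} (A : Set (FreeAb d c)) : Set (FreeAb d c) :=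
  {v | ∃ σ : SymInf, ∃ u ∈ A, v = act σ u}

/-- A subset `A ⊆ ℤ^{(I)}` is `Sym`-invariant if `Sym(A) ⊆ A`. -/
def IsSymInvariant {d c : ℕ} (A : Set (FreeAb d c)) : Prop :=
  orbitSet A ⊆ A

/-- `B` is an equivariant generating set of the lattice `L`: `B ⊆ L` and `Sym(B)` generates the
abelian group `L`. -/
def IsEquivariantGeneratingSet {d c : ℕ} (L : AddSubgroup (FreeAb d c))
    (B : Set (FreeAb d c)) : Prop :=
  B ⊆ (L : Set (FreeAb d c)) ∧ AddSubgroup.closure (orbitSet B) = L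

/-- `ℤ^{(I)}`, `I = ℕ^d × [c]`, is an equivariantly Noetherian `ℤ`-module: every `Sym`-invariant
lattice (that is, subgroup) in it has a finite equivariant generating set. -/
def IsEquivariantlyNoetherian (d c : ℕ) : Prop :=
  ∀ L : AddSubgroup (FreeAb d c), IsSymInvariant (L : Set (FreeAb d c)) →
    ∃ B : Set (FreeAb d c), B.Finite ∧ IsEquivariantGeneratingSet L B

end EquivLattice

namespace EquivLattice

/-! This is a Gröbner basis argument over `ℤ`. Order indices lexicographically. Strictly increasing
maps of `ℕ+` preserve this order and agree with elements of `Sym` on finite supports, so they move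
leading terms to leading terms. Pairs (leading index, positive leading coefficient) are
well-quasi-ordered by `IncDvd` together with `≤` (`wellQuasiOrdered_incDvd_prod_le`), so finitely
many elements of `L` have leading terms dividing all others; the division algorithm
`le_of_forall_exists_lead` shows that their orbits generate `L`. -/

/-- An injective map of the positive integers agrees on any finite set with an element of `Sym`. -/
theorem exists_symInf_eqOn {f : ℕ+ → ℕ+} (hf : Function.Injective f) (s : Finset ℕ+) :
    ∃ σ : SymInf, ∀ i ∈ s, σ.1 i = f i := by
  classical
  -- The bijection from `s` to its image extends to a permutation of the finite set `T`, then by the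
  -- identity.
  let T := s ∪ s.image f
  obtain ⟨τ, hτ⟩ := Equiv.Perm.exists_extending_pair (α := s) (β := {x // x ∈ T})
    (fun i => ⟨i, Finset.mem_union_left _ i.2⟩)
    (fun i => ⟨f i, Finset.mem_union_right _ (Finset.mem_image_of_mem f i.2)⟩)
    (fun i j h => Subtype.ext (Subtype.mk.inj h))
    (fun i j h => Subtype.ext (hf (Subtype.mk.inj h)))
  refine ⟨⟨Equiv.Perm.ofSubtype τ, ?_⟩, fun i hi => ?_⟩
  · refine T.finite_toSet.subset fun i hi => ?_
    by_contra h
    exact hi (Equiv.Perm.ofSubtype_apply_of_not_mem τ h)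
  · have hT : i ∈ T := Finset.mem_union_left _ hi
    change Equiv.Perm.ofSubtype τ i = f i
    rw [Equiv.Perm.ofSubtype_apply_of_mem τ hT]
    exact congrArg Subtype.val (hτ ⟨i, hi⟩)

/-- If the displacements `q k - p k` are nonnegative and monotone in `p k`, some strictly increasing
map carries the tuple `p` to the tuple `q`. -/
theorem exists_strictMono_map_tuple {ι : Type*} [Fintype ι] {p q : ι → ℕ+}
    (h : ∀ k, p k ≤ q k)
    (hδ : ∀ k l, p k ≤ p l → (q k : ℕ) - p k ≤ (q l : ℕ) - p l) :
    ∃ π : ℕ+ → ℕ+, StrictMono π ∧ ∀ k, π (p k) = q k := by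
  -- The largest displacement required at or below `n`, and `0` if there is none; it is monotone, so
  -- `n + δ n` is strictly increasing.
  let δ : ℕ+ → ℕ := fun n => (Finset.univ.filter (p · ≤ n)).sup fun k => (q k : ℕ) - p k
  refine ⟨fun n => ⟨n + δ n, by positivity⟩, fun m n hmn => ?_, fun k => ?_⟩
  · have hle : δ m ≤ δ n := Finset.sup_mono fun k hk => by
      simp only [Finset.mem_filter, Finset.mem_univ, true_and] at hk ⊢
      exact hk.trans hmn.le
    exact add_lt_add_of_lt_of_le (PNat.coe_lt_coe _ _ |>.2 hmn) hle
  · have hk : δ (p k) = (q k : ℕ) - p k := by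
      refine le_antisymm (Finset.sup_le fun l hl => ?_) ?_
      · exact hδ l k (by simpa using hl)
      · exact Finset.le_sup (f := fun k => (q k : ℕ) - p k) (by simp)
    apply PNat.eq
    have := PNat.coe_le_coe _ _ |>.2 (h k)
    simp only [PNat.mk_coe, hk]
    omega

/-- Divisibility of indices: `q` is the image of `p` under a strictly increasing map. -/
def IncDvd {d c : ℕ} (p q : Idx d c) : Prop :=
  ∃ π : ℕ+ → ℕ+, StrictMono π ∧ (∀ k, π (p.1 k) = q.1 k) ∧ p.2 = q.2

/-- Dickson's lemma: an index is encoded by finite data (order pattern of its entries, label) and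
natural numbers (entries, pairwise gaps). With equal patterns, growing gaps mean that displacements
increase with the entries. Truncated gaps are used only where the pattern makes them true
differences. -/
theorem wellQuasiOrdered_incDvd_prod_le (d c : ℕ) :
    WellQuasiOrdered fun x y : Idx d c × ℕ => IncDvd x.1 y.1 ∧ x.2 ≤ y.2 := by
  have heq : WellQuasiOrdered (fun a b : (Fin d → Fin d → Bool) × Fin c => a = b) :=
    Finite.wellQuasiOrdered _
  have hle : WellQuasiOrdered
      (fun a b : ((Fin d → ℕ) × (Fin d → Fin d → ℕ)) × ℕ => a ≤ b) := wellQuasiOrdered_le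
  intro f
  obtain ⟨m, n, hmn, h₁, h₂⟩ := (heq.prod hle) fun i =>
    ((fun k l => decide ((f i).1.1 k ≤ (f i).1.1 l), (f i).1.2),
      ((fun k => ((f i).1.1 k : ℕ), fun k l => ((f i).1.1 l : ℕ) - (f i).1.1 k), (f i).2))
  obtain ⟨hpat, hj⟩ := Prod.ext_iff.1 h₁
  obtain ⟨⟨hval, hgap⟩, hn⟩ := h₂
  have hval' : ∀ k, (f m).1.1 k ≤ (f n).1.1 k := hval
  refine ⟨m, n, hmn, ?_, hn⟩
  obtain ⟨π, hπ, hπk⟩ := exists_strictMono_map_tuple hval' fun k l hkl => by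
    have hg : ((f m).1.1 l : ℕ) - (f m).1.1 k ≤ ((f n).1.1 l : ℕ) - (f n).1.1 k := hgap k l
    have hp : decide ((f m).1.1 k ≤ (f m).1.1 l) = decide ((f n).1.1 k ≤ (f n).1.1 l) :=
      congrFun (congrFun hpat k) l
    have hkl' : (f n).1.1 k ≤ (f n).1.1 l := by simpa [hkl] using hp
    have h₁ := PNat.coe_le_coe _ _ |>.2 hkl
    have h₂ := PNat.coe_le_coe _ _ |>.2 hkl'
    have h₃ := PNat.coe_le_coe _ _ |>.2 (hval' k)
    have h₄ := PNat.coe_le_coe _ _ |>.2 (hval' l)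
    omega
  exact ⟨π, hπ, hπk, hj⟩

/-- In a well-quasi-order every set is dominated from below by a finite subset. -/
theorem _root_.WellQuasiOrdered.exists_finite_basis {α : Type*} {r : α → α → Prop}
    (hr : WellQuasiOrdered r) (S : Set α) :
    ∃ F : Finset α, (∀ x ∈ F, x ∈ S) ∧ ∀ y ∈ S, ∃ x ∈ F, r x y := by
  by_contra! h
  -- Without a finite basis, elements of `S` can be chosen successively, none above an earlier one:
  -- a bad sequence.
  obtain ⟨f, -, hf⟩ := exists_seq_of_forall_finset_exists (· ∈ S) (fun x y => ¬ r x y)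
    fun F hF => h F hF
  obtain ⟨m, n, hmn, hrmn⟩ := hr f
  exact hf m n hmn hrmn

/-- The lexicographic sort key of an index. -/
def lexKey {d c : ℕ} (p : Idx d c) : Lex (Fin d → ℕ+) ×ₗ Fin c :=
  toLex (toLex p.1, p.2)

theorem lexKey_injective {d c : ℕ} : Function.Injective (lexKey (d := d) (c := c)) := by
  intro p q h
  have h' := toLex.injective h
  exact Prod.ext (toLex.injective (Prod.ext_iff.1 h').1) (Prod.ext_iff.1 h').2

/-- The first differing coordinate stays first and keeps its direction. Arbitrary permutations lack
this property, hence the restriction to increasing maps in `IncDvd`. -/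
theorem lexKey_lt_of_strictMono {d c : ℕ} {π : ℕ+ → ℕ+} (hπ : StrictMono π) {p q : Idx d c}
    (h : lexKey p < lexKey q) :
    lexKey ((fun k => π (p.1 k), p.2) : Idx d c) < lexKey ((fun k => π (q.1 k), q.2) : Idx d c) := by
  rw [lexKey, lexKey, Prod.Lex.toLex_lt_toLex] at h ⊢
  rcases h with ⟨i, hi, hlt⟩ | ⟨heq, hlt⟩
  · exact Or.inl ⟨i, fun j hj => congrArg π (hi j hj), hπ hlt⟩
  · refine Or.inr ⟨?_, hlt⟩
    have h' : p.1 = q.1 := toLex.injective heq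
    simp only [h']

/-- `q` is the largest index occurring in `f`. -/
def IsLead {d c : ℕ} (f : FreeAb d c) (q : Idx d c) : Prop :=
  f q ≠ 0 ∧ ∀ i, f i ≠ 0 → lexKey i ≤ lexKey q

theorem exists_isLead {d c : ℕ} {f : FreeAb d c} (hf : f ≠ 0) : ∃ q, IsLead f q := by
  obtain ⟨q, hq, h⟩ := Finset.exists_max_image f.support lexKey (Finsupp.support_nonempty_iff.2 hf)
  exact ⟨q, Finsupp.mem_support_iff.1 hq, fun i hi => h i (Finsupp.mem_support_iff.2 hi)⟩

theorem idxAct_injective {d c : ℕ} (σ : SymInf) : Function.Injective (idxAct (d := d) (c := c) σ) :=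
  fun _ _ h => Prod.ext (funext fun k => σ.1.injective (congrFun (Prod.ext_iff.1 h).1 k))
    (Prod.ext_iff.1 h).2

theorem act_idxAct {d c : ℕ} (σ : SymInf) (g : FreeAb d c) (p : Idx d c) :
    act σ g (idxAct σ p) = g p :=
  Finsupp.mapDomain_apply (idxAct_injective σ) g p

theorem exists_of_act_apply_ne_zero {d c : ℕ} {σ : SymInf} {g : FreeAb d c} {i : Idx d c}
    (h : act σ g i ≠ 0) : ∃ p, g p ≠ 0 ∧ idxAct σ p = i := by
  by_cases hi : i ∈ Set.range (idxAct (d := d) (c := c) σ)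
  · obtain ⟨p, rfl⟩ := hi
    exact ⟨p, by rwa [act_idxAct] at h, rfl⟩
  · exact absurd (Finsupp.mapDomain_of_notMem_range g i hi) h

/-- If `p` is the leading index of `g` and divides `q`, some translate of `g` has leading index `q`
and the same leading coefficient. -/
theorem exists_act_isLead {d c : ℕ} {g : FreeAb d c} {p q : Idx d c} (hg : IsLead g p)
    (hpq : IncDvd p q) : ∃ σ : SymInf, act σ g q = g p ∧ IsLead (act σ g) q := by
  classical
  obtain ⟨π, hπ, hπk, hj⟩ := hpq
  obtain ⟨σ, hσ⟩ := exists_symInf_eqOn hπ.injective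
    (g.support.biUnion fun i => Finset.univ.image i.1)
  have hact : ∀ i, g i ≠ 0 → idxAct σ i = (fun k => π (i.1 k), i.2) := by
    intro i hi
    refine Prod.ext (funext fun k => hσ _ ?_) rfl
    exact Finset.mem_biUnion.2 ⟨i, Finsupp.mem_support_iff.2 hi,
      Finset.mem_image_of_mem _ (Finset.mem_univ k)⟩
  have hq : idxAct σ p = q := by
    rw [hact p hg.1]
    exact Prod.ext (funext hπk) hj
  have hcoef : act σ g q = g p := by rw [← hq, act_idxAct]
  refine ⟨σ, hcoef, hcoef ▸ hg.1, fun i hi => ?_⟩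
  obtain ⟨r, hr, rfl⟩ := exists_of_act_apply_ne_zero hi
  rcases (hg.2 r hr).lt_or_eq with hlt | heq
  · rw [← hq, hact r hr, hact p hg.1]
    exact (lexKey_lt_of_strictMono hπ hlt).le
  · rw [lexKey_injective heq, hq]

/-- The division algorithm: if every positive leading term of `L` is divisible, with no larger
coefficient, by a leading term of an element of the invariant subgroup `M`, then `L ≤ M`. -/
theorem le_of_forall_exists_lead {d c : ℕ} {L M : AddSubgroup (FreeAb d c)} (hML : M ≤ L)
    (hM : ∀ (σ : SymInf), ∀ g ∈ M, act σ g ∈ M)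
    (h : ∀ f ∈ L, ∀ q, IsLead f q → 0 < f q →
      ∃ g ∈ M, ∃ p, IsLead g p ∧ IncDvd p q ∧ 0 < g p ∧ g p ≤ f q) : L ≤ M := by
  -- Outer induction on the leading index, inner induction on the absolute value of the leading
  -- coefficient.
  have key : ∀ (k : Lex (Fin d → ℕ+) ×ₗ Fin c) (n : ℕ), ∀ f ∈ L, ∀ q, IsLead f q →
      lexKey q = k → (f q).natAbs = n → f ∈ M := by
    intro k
    induction k using WellFoundedLT.induction with | _ k ihk
    intro n
    induction n using Nat.strong_induction_on with | _ n ihn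
    have pos : ∀ f ∈ L, ∀ q, IsLead f q → lexKey q = k → (f q).natAbs = n → 0 < f q → f ∈ M := by
      rintro f hf q hq rfl rfl hpos
      obtain ⟨g, hgM, p, hgp, hpq, hgpos, hgle⟩ := h f hf q hq hpos
      obtain ⟨σ, hcoef, hlead⟩ := exists_act_isLead hgp hpq
      have hσM : act σ g ∈ M := hM σ g hgM
      suffices f - act σ g ∈ M by simpa using add_mem this hσM
      by_cases h0 : f - act σ g = 0
      · rw [h0]; exact zero_mem M
      obtain ⟨r, hr⟩ := exists_isLead h0
      have hrL : f - act σ g ∈ L := sub_mem hf (hML hσM)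
      have hrq : lexKey r ≤ lexKey q := by
        by_cases hfr : f r = 0
        · refine hlead.2 r fun hgr => hr.1 ?_
          rw [Finsupp.sub_apply, hfr, hgr, sub_zero]
        · exact hq.2 r hfr
      rcases hrq.lt_or_eq with hlt | heq
      · exact ihk _ hlt _ _ hrL r hr rfl rfl
      -- The leading index survives, but `0 < g p ≤ f q` makes the coefficient strictly smaller.
      · obtain rfl := lexKey_injective heq
        refine ihn _ ?_ _ hrL r hr rfl rfl
        rw [Finsupp.sub_apply, hcoef]
        omega
    intro f hf q hq hk hn
    rcases lt_or_gt_of_ne hq.1 with hneg | hpos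
    · refine neg_mem_iff.1 (pos (-f) (neg_mem hf) q ?_ hk ?_ ?_)
      · simpa [IsLead] using hq
      · simpa using hn
      · simpa using hneg
    · exact pos f hf q hq hk hn hpos
  intro f hf
  by_cases h0 : f = 0
  · rw [h0]; exact zero_mem M
  · obtain ⟨q, hq⟩ := exists_isLead h0
    exact key _ _ f hf q hq rfl rfl

theorem act_act {d c : ℕ} (σ τ : SymInf) (f : FreeAb d c) : act σ (act τ f) = act (σ * τ) f :=
  Finsupp.mapDomain_comp.symm

theorem act_one {d c : ℕ} (f : FreeAb d c) : act 1 f = f :=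
  Finsupp.mapDomain_id

theorem act_mem_closure_orbitSet {d c : ℕ} {B : Set (FreeAb d c)} (σ : SymInf) {g : FreeAb d c}
    (hg : g ∈ AddSubgroup.closure (orbitSet B)) : act σ g ∈ AddSubgroup.closure (orbitSet B) := by
  suffices AddSubgroup.closure (orbitSet B) ≤ (AddSubgroup.closure (orbitSet B)).comap (act σ) from
    this hg
  refine (AddSubgroup.closure_le _).2 ?_
  rintro _ ⟨τ, u, hu, rfl⟩
  exact AddSubgroup.subset_closure ⟨σ * τ, u, hu, act_act σ τ u⟩

theorem isEquivariantlyNoetherian (d c : ℕ) : IsEquivariantlyNoetherian d c := by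
  classical
  intro L hL
  -- Finite basis of the set of leading terms of `L` with positive coefficient; `b` below picks an
  -- element of `L` realizing each.
  obtain ⟨F, hFS, hF⟩ := (wellQuasiOrdered_incDvd_prod_le d c).exists_finite_basis
    {x | ∃ f ∈ L, IsLead f x.1 ∧ 0 < x.2 ∧ f x.1 = x.2}
  choose! b hbL hb using hFS
  have hbL' : b '' F ⊆ L := by
    rintro _ ⟨x, hx, rfl⟩
    exact hbL x hx
  have hle : AddSubgroup.closure (orbitSet (b '' F)) ≤ L := by
    refine (AddSubgroup.closure_le _).2 ?_
    rintro _ ⟨σ, u, hu, rfl⟩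
    exact hL ⟨σ, u, hbL' hu, rfl⟩
  refine ⟨b '' F, F.finite_toSet.image b, hbL', le_antisymm hle ?_⟩
  refine le_of_forall_exists_lead hle (fun σ g hg => act_mem_closure_orbitSet σ hg) ?_
  intro f hf q hq hpos
  obtain ⟨x, hx, hdvd, hxle⟩ := hF (q, (f q).toNat)
    ⟨f, hf, hq, by simpa using hpos, (Int.toNat_of_nonneg hpos.le).symm⟩
  obtain ⟨hlead, hxpos, hcoef⟩ := hb x hx
  refine ⟨b x, AddSubgroup.subset_closure ⟨1, b x, ⟨x, hx, rfl⟩, (act_one _).symm⟩,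
    x.1, hlead, hdvd, ?_, ?_⟩
  · rw [hcoef]; exact_mod_cast hxpos
  · rw [hcoef]
    have : x.2 ≤ (f q).toNat := hxle
    omega

end EquivLattice

theorem theorem5p1 (d c : ℕ) (hd : 0 < d) (hc : 0 < c) :
    EquivLattice.IsEquivariantlyNoetherian d c :=
  EquivLattice.isEquivariantlyNoetherian d c
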